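/- Let $d\ge 1$, let $\mathcal O\subseteq\mathbb R^d$ be a bounded open set with smooth boundary (connectedness is not required), and let $f_{\min},g_{\min}>0$. For integers $k\ge 1$, $C^k(\mathcal O)$ denotes the $k$-times continuously differentiable functions on $\mathcal O$ with finite norm $\|u\|_{C^k}=\max_{|\beta|\le k}\sup_{x\in\mathcal O}|\partial^\beta u(x)|$, and $H^2(\mathcal O)$ denotes the $L^2(\mathcal O)$-Sobolev space of functions whose weak derivatives up to order $2$ are in $L^2(\mathcal O)$, with norm $\|u\|_{H^2}=\bigl(\|u\|_{L^2}^2+\sum_i\|\partial_iu\|_{L^2}^2+\sum_{i,j}\|\partial_i\partial_ju\|_{L^2}^2\bigr)^{1/2}$. For every $B>0$ there exists a constant $C>0$, depending only on $f_{\min}$, $g_{\min}$, $\mathcal O$ and $B$, such that the following holds. Suppose that for $i\in\{1,2\}$ we have functions $$u_i\in H^2(\mathcal O),\qquad f_i\in C^1(\mathcal O),\qquad g_i\in L^2(\mathcal O)\qquad\text{with}\qquad \nabla\cdot(f_i\nabla u_i)=g_i\ \text{ on }\mathcal O$$ (in the weak sense), and that the first triplet additionally satisfies $u_1\in C^2(\mathcal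 O)\cap C(\overline{\mathcal O})$, $g_1\in C(\mathcal O)$, $$\inf_{x\in\mathcal O}f_1(x)\ge f_{\min},\qquad \inf_{x\in\mathcal O}g_1(x)\ge g_{\min},\qquad u_1|_{\partial\mathcal O}=0,$$ and $\max(\|f_1\|_{C^1},\|u_1\|_{C^2})\le B$. Then $$\|f_1-f_2\|_{L^2}\le C\bigl(\|f_2\|_{C^1}\,\|u_1-u_2\|_{H^2}+\|g_1-g_2\|_{L^2}\bigr).$$ -/

import Mathlib

open MeasureTheory Topology
open scoped ENNReal NNReal ContDiff

namespace Darcy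

noncomputable section

/-- `O` is a bounded open subset of `ℝ^d` with smooth boundary: near each of its boundary points,
`O` is the sublevel set `{ρ < 0}` of a smooth function `ρ` with nonvanishing derivative there.
Connectedness is not required. -/
structure IsSmoothBoundedDomain {d : ℕ} (O : Set (EuclideanSpace ℝ (Fin d))) : Prop where
  isOpen : IsOpen O
  isBounded : Bornology.IsBounded O
  smooth_boundary : ∀ x₀ ∈ frontier O,
    ∃ (U : Set (EuclideanSpace ℝ (Fin d))) (ρ : EuclideanSpace ℝ (Fin d) → ℝ),
      IsOpen U ∧ x₀ ∈ U ∧ ContDiffOn ℝ ∞ ρ U ∧ fderiv ℝ ρ x₀ ≠ 0 ∧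
        ∀ x ∈ U, (x ∈ O ↔ ρ x < 0)

/-- The classical partial derivative `∂ᵢ u`. -/
def partialDeriv {d : ℕ} (i : Fin d) (u : EuclideanSpace ℝ (Fin d) → ℝ) :
    EuclideanSpace ℝ (Fin d) → ℝ :=
  fun x => fderiv ℝ u x (EuclideanSpace.single i 1)

/-- The iterated classical partial derivative `∂_{i₁} ⋯ ∂_{iₙ} u` along a list of coordinates. -/
def iterPartial {d : ℕ} :
    List (Fin d) → (EuclideanSpace ℝ (Fin d) → ℝ) → EuclideanSpace ℝ (Fin d) → ℝ
  | [], u => u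
  | i :: l, u => partialDeriv i (iterPartial l u)

/-- The `C^k(O)` norm: the largest supremum over `O` of a partial derivative of order at most `k`.
It is extended-real valued, so that it is `∞` if some such derivative is unbounded. -/
def ckNorm {d : ℕ} (k : ℕ) (O : Set (EuclideanSpace ℝ (Fin d)))
    (u : EuclideanSpace ℝ (Fin d) → ℝ) : ℝ≥0∞ :=
  ⨆ (l : List (Fin d)) (_ : l.length ≤ k) (x ∈ O), ‖iterPartial l u x‖ₑ

/-- `u ∈ C^k(O)`: `u` is `k` times continuously differentiable on the open set `O`, with all
partial derivatives of order at most `k` bounded on `O`. -/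
def MemCk {d : ℕ} (k : ℕ) (O : Set (EuclideanSpace ℝ (Fin d)))
    (u : EuclideanSpace ℝ (Fin d) → ℝ) : Prop :=
  ContDiffOn ℝ k u O ∧ ckNorm k O u < ⊤

/-- Test functions: `φ ∈ C_c^∞(O)`. -/
def IsTestFunction {d : ℕ} (O : Set (EuclideanSpace ℝ (Fin d)))
    (φ : EuclideanSpace ℝ (Fin d) → ℝ) : Prop :=
  ContDiff ℝ ∞ φ ∧ HasCompactSupport φ ∧ tsupport φ ⊆ O

/-- `v` is a weak derivative `∂_{i₁} ⋯ ∂_{iₙ} u` on `O`, where `l = [i₁, …, iₙ]`. -/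
def IsWeakDeriv {d : ℕ} (O : Set (EuclideanSpace ℝ (Fin d))) (l : List (Fin d))
    (u v : EuclideanSpace ℝ (Fin d) → ℝ) : Prop :=
  LocallyIntegrableOn u O ∧ LocallyIntegrableOn v O ∧
    ∀ φ, IsTestFunction O φ →
      ∫ x in O, u x * iterPartial l φ x = (-1) ^ l.length * ∫ x in O, v x * φ x

open Classical in
/-- The weak derivative `∂_{i₁} ⋯ ∂_{iₙ} u` on `O` (unique up to null sets), and `0` if there is
none. -/
def weakDeriv {d : ℕ} (O : Set (EuclideanSpace ℝ (Fin d))) (l : List (Fin d))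
    (u : EuclideanSpace ℝ (Fin d) → ℝ) : EuclideanSpace ℝ (Fin d) → ℝ :=
  if h : ∃ v, IsWeakDeriv O l u v then h.choose else 0

/-- The norm of `L²(O)`, extended-real valued. -/
def l2Norm {d : ℕ} (O : Set (EuclideanSpace ℝ (Fin d)))
    (u : EuclideanSpace ℝ (Fin d) → ℝ) : ℝ≥0∞ :=
  eLpNorm u 2 (volume.restrict O)

/-- `u ∈ L²(O)`. -/
def MemL2 {d : ℕ} (O : Set (EuclideanSpace ℝ (Fin d)))
    (u : EuclideanSpace ℝ (Fin d) → ℝ) : Prop :=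
  MemLp u 2 (volume.restrict O)

/-- `u ∈ H^k(O)`: `u` has weak derivatives in `L²(O)` of all orders up to `k`
(for the empty list this says that `u` itself is in `L²(O)`). -/
def MemHk {d : ℕ} (k : ℕ) (O : Set (EuclideanSpace ℝ (Fin d)))
    (u : EuclideanSpace ℝ (Fin d) → ℝ) : Prop :=
  ∀ l : List (Fin d), l.length ≤ k → ∃ v, IsWeakDeriv O l u v ∧ MemL2 O v

/-- The `H^k(O)` norm of a function `u ∈ H^k(O)`:
`(∑_{n ≤ k} ∑_{i₁, …, iₙ} ‖∂_{i₁} ⋯ ∂_{iₙ} u‖²_{L²(O)})^{1/2}` with weak derivatives. -/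
def hkNorm {d : ℕ} (k : ℕ) (O : Set (EuclideanSpace ℝ (Fin d)))
    (u : EuclideanSpace ℝ (Fin d) → ℝ) : ℝ≥0∞ :=
  (∑ n ∈ Finset.range (k + 1), ∑ ι : Fin n → Fin d,
    l2Norm O (weakDeriv O (List.ofFn ι) u) ^ 2) ^ (1 / 2 : ℝ)

/-- `∇ · F = g` on `O` in the weak sense, for a vector field `F = (F₁, …, F_d)`. -/
def HasWeakDivergence {d : ℕ} (O : Set (EuclideanSpace ℝ (Fin d)))
    (F : Fin d → EuclideanSpace ℝ (Fin d) → ℝ) (g : EuclideanSpace ℝ (Fin d) → ℝ) : Prop :=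
  (∀ i, LocallyIntegrableOn (F i) O) ∧ LocallyIntegrableOn g O ∧
    ∀ φ, IsTestFunction O φ →
      ∫ x in O, ∑ i, F i x * partialDeriv i φ x = -∫ x in O, g x * φ x

/-- `∇ · (f ∇u) = g` on `O`, where `∇u` is the weak gradient of `u` and the divergence is weak. -/
def SolvesDarcy {d : ℕ} (O : Set (EuclideanSpace ℝ (Fin d)))
    (f u g : EuclideanSpace ℝ (Fin d) → ℝ) : Prop :=
  HasWeakDivergence O (fun i x => f x * weakDeriv O [i] u x) g

end

end Darcy

/-! Put `h = f₁ - f₂` and `T h = ∇ · (h ∇u₁)`. Subtracting the two equations gives `T h = (g₁ - g₂)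
- ∇ · (f₂ ∇(u₁ - u₂))`, whose `L²` norm is bounded by the data (`l2Norm_transport_sub_le`). What
remains is `‖h‖ ≤ K ‖T h‖` in `L²`, although `h` need not vanish on the boundary (`energy_le`).

Where `∇u₁` is small, `f₁ Δu₁` must carry the lower bound on `g₁`; elsewhere `|∇u₁|²` is bounded
below. Hence `Δu₁ + lam |∇u₁|² ≥ c > 0` for large `lam` (`coercive_of_bounds`). For the weight `w =
exp (-lam u₁)` one has `∇ · (h² w ∇u₁) = 2 h w T h - h² w (Δu₁ + lam |∇u₁|²)`, so if the left side
has nonnegative integral, then `c ∫ h² w ≤ 2 ∫ h w T h`, and Young's inequality finishes.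

The sign at the boundary comes from the maximum principle: `u₁ < 0` inside `O` and `u₁ = 0` on the
frontier, so `u₁` increases towards the boundary. To avoid traces, `w` is multiplied by a cutoff
that is a decreasing function of `u₁`. The divergence then integrates to zero, and the derivative of
the cutoff only adds a term of the favourable sign (`deriv_cutoffWeight_le`, `weighted_energy_le`).
Dominated convergence removes the cutoff. -/

namespace Darcy

variable {d : ℕ} {O : Set (EuclideanSpace ℝ (Fin d))}
  {u v F f h w φ ψ u₁ u₂ f₁ f₂ g₁ g₂ : EuclideanSpace ℝ (Fin d) → ℝ}

/-! ### Test functions, mollification and integration by parts. -/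

/-- Continuously differentiable functions with compact support in `O`. -/
structure IsC1TestFunction {d : ℕ} (O : Set (EuclideanSpace ℝ (Fin d)))
    (φ : EuclideanSpace ℝ (Fin d) → ℝ) : Prop where
  contDiff : ContDiff ℝ 1 φ
  hasCompactSupport : HasCompactSupport φ
  tsupport_subset : tsupport φ ⊆ O

theorem IsTestFunction.isC1TestFunction (h : IsTestFunction O φ) : IsC1TestFunction O φ :=
  ⟨h.1.of_le (by simp), h.2.1, h.2.2⟩

theorem tsupport_partialDeriv_subset (i : Fin d) (φ : EuclideanSpace ℝ (Fin d) → ℝ) :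
    tsupport (partialDeriv i φ) ⊆ tsupport φ := by
  refine closure_minimal (fun x hx => ?_) isClosed_closure
  refine support_fderiv_subset ℝ (f := φ) (fun h => hx ?_)
  simp [partialDeriv, h]

theorem hasCompactSupport_partialDeriv (i : Fin d) (h : HasCompactSupport φ) :
    HasCompactSupport (partialDeriv i φ) :=
  h.of_isClosed_subset isClosed_closure (tsupport_partialDeriv_subset i φ)

theorem IsTestFunction.partialDeriv (h : IsTestFunction O φ) (i : Fin d) :
    IsTestFunction O (partialDeriv i φ) := by
  refine ⟨?_, hasCompactSupport_partialDeriv i h.2.1,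
    (tsupport_partialDeriv_subset i φ).trans h.2.2⟩
  exact (h.1.fderiv_right (m := ∞) (by simp)).clm_apply contDiff_const

theorem IsC1TestFunction.continuous_partialDeriv (h : IsC1TestFunction O φ) (i : Fin d) :
    Continuous (Darcy.partialDeriv i φ) :=
  (h.contDiff.continuous_fderiv (by simp)).clm_apply continuous_const

theorem continuousOn_partialDeriv (hO : IsOpen O) (h : ContDiffOn ℝ 1 F O) (i : Fin d) :
    ContinuousOn (partialDeriv i F) O :=
  (h.continuousOn_fderiv_of_isOpen hO (by simp)).clm_apply continuousOn_const

theorem contDiffOn_partialDeriv (hO : IsOpen O) (h : ContDiffOn ℝ 2 F O) (i : Fin d) :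
    ContDiffOn ℝ 1 (partialDeriv i F) O :=
  (h.fderiv_of_isOpen hO (by norm_num)).clm_apply contDiffOn_const

/-- A continuously differentiable function on `O` that vanishes off a compact subset of `O`
is a `C¹` test function. -/
theorem IsC1TestFunction.of_support_subset (hO : IsOpen O) (hF : ContDiffOn ℝ 1 F O)
    {K : Set (EuclideanSpace ℝ (Fin d))} (hK : IsCompact K) (hKO : K ⊆ O)
    (hs : Function.support F ⊆ K) : IsC1TestFunction O F := by
  have ht : tsupport F ⊆ K := closure_minimal hs hK.isClosed
  refine ⟨contDiff_iff_contDiffAt.2 fun x => ?_, hK.of_isClosed_subset isClosed_closure ht,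
    ht.trans hKO⟩
  by_cases hx : x ∈ tsupport F
  · exact hF.contDiffAt (hO.mem_nhds (hKO (ht hx)))
  · exact contDiffAt_const.congr_of_eventuallyEq (notMem_tsupport_iff_eventuallyEq.1 hx)

theorem IsC1TestFunction.mul (hO : IsOpen O) (hF : ContDiffOn ℝ 1 F O)
    (h : IsC1TestFunction O φ) : IsC1TestFunction O (fun x => F x * φ x) := by
  refine .of_support_subset hO (hF.mul h.contDiff.contDiffOn) h.hasCompactSupport
    h.tsupport_subset fun x hx => subset_tsupport _ ?_
  exact right_ne_zero_of_mul hx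

theorem partialDeriv_mul {x : EuclideanSpace ℝ (Fin d)} (hu : DifferentiableAt ℝ u x)
    (hv : DifferentiableAt ℝ v x) (i : Fin d) :
    partialDeriv i (fun y => u y * v y) x
      = u x * partialDeriv i v x + partialDeriv i u x * v x := by
  simp [partialDeriv, fderiv_fun_mul hu hv]
  ring

theorem IsC1TestFunction.integral_partialDeriv (h : IsC1TestFunction O φ) (i : Fin d) :
    ∫ x, Darcy.partialDeriv i φ x = 0 := by
  have h1 : Integrable (fun x => fderiv ℝ φ x (EuclideanSpace.single i 1)) :=
    (h.continuous_partialDeriv i).integrable_of_hasCompactSupport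
      (hasCompactSupport_partialDeriv i h.hasCompactSupport)
  have h2 : Integrable φ := h.contDiff.continuous.integrable_of_hasCompactSupport
    h.hasCompactSupport
  have := integral_mul_fderiv_eq_neg_fderiv_mul_of_integrable (f := fun _ => (1 : ℝ)) (g := φ)
    (v := EuclideanSpace.single i 1) (μ := volume)
    (by simp) (by simpa using h1) (by simpa using h2) (fun x _ => by fun_prop)
    (fun x _ => h.contDiff.differentiable (by simp) x)
  simpa [Darcy.partialDeriv] using this

theorem setIntegral_eq_of_tsupport (h : tsupport φ ⊆ O) : ∫ x in O, φ x = ∫ x, φ x :=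
  setIntegral_eq_integral_of_forall_compl_eq_zero fun _ hx =>
    image_eq_zero_of_notMem_tsupport fun h' => hx (h h')

theorem IsC1TestFunction.setIntegral_partialDeriv (h : IsC1TestFunction O φ) (i : Fin d) :
    ∫ x in O, Darcy.partialDeriv i φ x = 0 := by
  rw [setIntegral_eq_of_tsupport ((tsupport_partialDeriv_subset i φ).trans h.tsupport_subset),
    h.integral_partialDeriv]

/-- A locally integrable function times a continuous function with compact support in `O`. -/
theorem integrableOn_mul_of_hasCompactSupport (hu : LocallyIntegrableOn u O)
    (hφ : Continuous φ) (hc : HasCompactSupport φ) (hs : tsupport φ ⊆ O) :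
    IntegrableOn (fun x => u x * φ x) O := by
  have h1 : IntegrableOn u (tsupport φ) := hu.integrableOn_compact_subset hs hc
  have h2 : IntegrableOn (fun x => u x * φ x) (tsupport φ) :=
    h1.mul_continuousOn hφ.continuousOn hc
  have h3 : Integrable (fun x => u x * φ x) := by
    rwa [integrableOn_iff_integrable_of_support_subset] at h2
    intro x hx
    exact subset_tsupport _ (right_ne_zero_of_mul hx)
  exact h3.integrableOn

/-- Uniform approximation of a `C¹` test function, with its derivatives, by test functions. -/
theorem IsC1TestFunction.exists_approx (hO : IsOpen O) (h : IsC1TestFunction O ψ) :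
    ∃ K, IsCompact K ∧ K ⊆ O ∧ tsupport ψ ⊆ K ∧ ∀ ε > 0, ∃ φ, IsTestFunction O φ ∧
      tsupport φ ⊆ K ∧ (∀ x, |φ x - ψ x| ≤ ε) ∧
      ∀ i x, |Darcy.partialDeriv i φ x - Darcy.partialDeriv i ψ x| ≤ ε := by
  -- The compact set is fixed before `ε`, so that integrals of locally integrable functions over it
  -- are constants as `ε → 0`.
  obtain ⟨δ, hδ, hδO⟩ := h.hasCompactSupport.isCompact.exists_cthickening_subset_open hO
    h.tsupport_subset
  have hKc : IsCompact (Metric.cthickening δ (tsupport ψ)) :=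
    h.hasCompactSupport.isCompact.cthickening
  refine ⟨_, hKc, hδO, Metric.self_subset_cthickening _, fun ε hε => ?_⟩
  have hdc := h.contDiff.continuous_fderiv (by simp)
  have hu1 := Metric.uniformContinuous_iff.1
    (h.hasCompactSupport.uniformContinuous_of_continuous h.contDiff.continuous) ε hε
  have hu2 := Metric.uniformContinuous_iff.1
    ((h.hasCompactSupport.fderiv ℝ).uniformContinuous_of_continuous hdc) ε hε
  obtain ⟨r₁, hr₁, hr₁'⟩ := hu1
  obtain ⟨r₂, hr₂, hr₂'⟩ := hu2
  have hr : 0 < min δ (min r₁ r₂) := lt_min hδ (lt_min hr₁ hr₂)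
  -- Radius `δ` keeps the mollified support in the thickening; `r₁` and `r₂` are moduli of uniform
  -- continuity of `ψ` and of its derivative.
  let η : ContDiffBump (0 : EuclideanSpace ℝ (Fin d)) :=
    ⟨min δ (min r₁ r₂) / 2, min δ (min r₁ r₂), by linarith, by linarith⟩
  have hη : η.rOut = min δ (min r₁ r₂) := rfl
  have hs : tsupport (convolution (η.normed volume) ψ (ContinuousLinearMap.lsmul ℝ ℝ) volume)
      ⊆ Metric.cthickening δ (tsupport ψ) := by
    refine closure_minimal ((support_convolution_subset _).trans ?_) hKc.isClosed
    rintro _ ⟨a, ha, b, hb, rfl⟩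
    rw [η.support_normed_eq, hη] at ha
    refine Metric.mem_cthickening_of_dist_le _ b _ _ (subset_tsupport _ hb) ?_
    have : ‖a‖ < min δ (min r₁ r₂) := by simpa using ha
    simpa using (this.trans_le (min_le_left _ _)).le
  refine ⟨convolution (η.normed volume) ψ (ContinuousLinearMap.lsmul ℝ ℝ) volume,
    ⟨?_, hKc.of_isClosed_subset isClosed_closure hs, hs.trans hδO⟩, hs, fun x => ?_,
    fun i x => ?_⟩
  · exact η.hasCompactSupport_normed.contDiff_convolution_left _ η.contDiff_normed
      h.contDiff.continuous.locallyIntegrable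
  · rw [← Real.dist_eq]
    refine η.dist_normed_convolution_le h.contDiff.continuous.aestronglyMeasurable
      fun y hy => (hr₁' ?_).le
    exact (Metric.mem_ball.1 hy).trans_le ((min_le_right _ _).trans (min_le_left _ _))
  · have h1 := h.hasCompactSupport.hasFDerivAt_convolution_right
      (ContinuousLinearMap.lsmul ℝ ℝ) (f := η.normed volume) (μ := volume)
      (η.continuous_normed.locallyIntegrable) h.contDiff x
    have h2 : dist (convolution (η.normed volume) (fderiv ℝ ψ) (ContinuousLinearMap.lsmul ℝ ℝ)
        volume x) (fderiv ℝ ψ x) ≤ ε := by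
      refine η.dist_normed_convolution_le hdc.aestronglyMeasurable fun y hy => (hr₂' ?_).le
      exact (Metric.mem_ball.1 hy).trans_le ((min_le_right _ _).trans (min_le_right _ _))
    have h3 : convolution (η.normed volume) (fderiv ℝ ψ)
        ((ContinuousLinearMap.lsmul ℝ ℝ).precompR (EuclideanSpace ℝ (Fin d))) volume x
        = convolution (η.normed volume) (fderiv ℝ ψ) (ContinuousLinearMap.lsmul ℝ ℝ)
        volume x := by
      simp only [convolution]
      rfl
    simp only [Darcy.partialDeriv]
    rw [h1.fderiv, h3, ← sub_apply, ← Real.norm_eq_abs]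
    refine (ContinuousLinearMap.le_opNorm _ _).trans ?_
    rw [dist_eq_norm] at h2
    simpa using h2

/-- Weak derivatives may be tested against `C¹` functions. -/
theorem weak_ibp_c1 (hO : IsOpen O) (i : Fin d) (hu : LocallyIntegrableOn u O)
    (hv : LocallyIntegrableOn v O)
    (huv : ∀ φ, IsTestFunction O φ →
      ∫ x in O, u x * partialDeriv i φ x = - ∫ x in O, v x * φ x)
    (hψ : IsC1TestFunction O ψ) :
    ∫ x in O, u x * partialDeriv i ψ x = - ∫ x in O, v x * ψ x := by
  obtain ⟨K, hK, hKO, hψK, happ⟩ := hψ.exists_approx hO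
  have huK : IntegrableOn u K := hu.integrableOn_compact_subset hKO hK
  have hvK : IntegrableOn v K := hv.integrableOn_compact_subset hKO hK
  set M : ℝ := (∫ x in K, |u x|) + ∫ x in K, |v x| with hM
  have hM0 : 0 ≤ M := by positivity
  have key : ∀ (w a b : EuclideanSpace ℝ (Fin d) → ℝ) (ε : ℝ), IntegrableOn w K →
      IntegrableOn (fun x => w x * a x) O → IntegrableOn (fun x => w x * b x) O →
      tsupport a ⊆ K → tsupport b ⊆ K → (∀ x, |a x - b x| ≤ ε) →
      |(∫ x in O, w x * a x) - ∫ x in O, w x * b x| ≤ ε * ∫ x in K, |w x| := by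
    intro w a b ε hw ha hb hsa hsb hab
    rw [← integral_sub ha hb, setIntegral_eq_of_subset_of_forall_sdiff_eq_zero hO.measurableSet hKO,
      ← integral_const_mul, ← Real.norm_eq_abs]
    · refine norm_integral_le_of_norm_le (hw.abs.const_mul ε) (.of_forall fun x => ?_)
      rw [← mul_sub, norm_mul, mul_comm, Real.norm_eq_abs, Real.norm_eq_abs]
      exact mul_le_mul_of_nonneg_right (hab x) (abs_nonneg _)
    · intro x hx
      rw [image_eq_zero_of_notMem_tsupport fun h' => hx.2 (hsa h'),
        image_eq_zero_of_notMem_tsupport fun h' => hx.2 (hsb h')]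
      simp
  have hle : ∀ ε > 0, |(∫ x in O, u x * partialDeriv i ψ x) + ∫ x in O, v x * ψ x| ≤ ε * M := by
    intro ε hε
    obtain ⟨φ, hφ, hφK, h0, h1⟩ := happ ε hε
    have hφ1 := hφ.isC1TestFunction
    have int1 : ∀ χ, IsC1TestFunction O χ →
        IntegrableOn (fun x => u x * partialDeriv i χ x) O := fun χ hχ =>
      integrableOn_mul_of_hasCompactSupport hu (hχ.continuous_partialDeriv i)
        (hasCompactSupport_partialDeriv i hχ.hasCompactSupport)
        ((tsupport_partialDeriv_subset i χ).trans hχ.tsupport_subset)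
    have int0 : ∀ χ, IsC1TestFunction O χ → IntegrableOn (fun x => v x * χ x) O := fun χ hχ =>
      integrableOn_mul_of_hasCompactSupport hv hχ.contDiff.continuous hχ.hasCompactSupport
        hχ.tsupport_subset
    have e1 := key u (partialDeriv i φ) (partialDeriv i ψ) ε huK (int1 φ hφ1) (int1 ψ hψ)
      ((tsupport_partialDeriv_subset i φ).trans hφK)
      ((tsupport_partialDeriv_subset i ψ).trans hψK) (h1 i)
    have e0 := key v φ ψ ε hvK (int0 φ hφ1) (int0 ψ hψ) hφK hψK h0
    have := huv φ hφ
    rw [abs_le] at e0 e1 ⊢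
    constructor <;> rw [hM] <;> linarith [e0.1, e0.2, e1.1, e1.2]
  have h0 : |(∫ x in O, u x * partialDeriv i ψ x) + ∫ x in O, v x * ψ x| ≤ 0 := by
    refine le_of_forall_pos_le_add fun ε hε => ?_
    have := hle (ε / (M + 1)) (by positivity)
    refine this.trans ?_
    rw [zero_add, div_mul_eq_mul_div, div_le_iff₀ (by positivity)]
    nlinarith
  linarith [abs_nonpos_iff.1 h0]

/-! ### Calculus of weak derivatives and the expanded form of the equation. -/

/-- The fundamental lemma of the calculus of variations. -/
theorem ae_eq_of_forall_testFunction (hO : IsOpen O) (hu : LocallyIntegrableOn u O)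
    (hv : LocallyIntegrableOn v O)
    (h : ∀ φ, IsTestFunction O φ → ∫ x in O, u x * φ x = ∫ x in O, v x * φ x) :
    u =ᵐ[volume.restrict O] v := by
  have := hO.ae_eq_zero_of_integral_contDiff_smul_eq_zero (μ := volume) (hu.sub hv)
    fun φ h1 h2 h3 => by
      have hi : ∀ w, LocallyIntegrableOn w O → IntegrableOn (fun x => w x * φ x) O := fun w hw =>
        integrableOn_mul_of_hasCompactSupport hw h1.continuous h2 h3
      have e := h φ ⟨h1, h2, h3⟩
      rw [← sub_eq_zero, ← integral_sub (hi u hu) (hi v hv),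
        setIntegral_eq_integral_of_forall_compl_eq_zero] at e
      · rw [← e]
        refine integral_congr_ae (.of_forall fun x => ?_)
        simp only [Pi.sub_apply, smul_eq_mul]
        ring
      · intro x hx
        rw [image_eq_zero_of_notMem_tsupport fun h' => hx (h3 h')]
        simp
  refine (ae_restrict_iff' hO.measurableSet).2 (this.mono fun x hx hxO => ?_)
  exact sub_eq_zero.1 (hx hxO)

theorem IsWeakDeriv.ae_unique (hO : IsOpen O) {l : List (Fin d)}
    {w : EuclideanSpace ℝ (Fin d) → ℝ} (hv : IsWeakDeriv O l u v) (hw : IsWeakDeriv O l u w) :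
    v =ᵐ[volume.restrict O] w := by
  refine ae_eq_of_forall_testFunction hO hv.2.1 hw.2.1 fun φ hφ => ?_
  have := (hv.2.2 φ hφ).symm.trans (hw.2.2 φ hφ)
  exact mul_left_cancel₀ (by simp) this

theorem IsWeakDeriv.sub {l : List (Fin d)}
    {u' v' : EuclideanSpace ℝ (Fin d) → ℝ} (hv : IsWeakDeriv O l u v)
    (hw : IsWeakDeriv O l u' v') :
    IsWeakDeriv O l (fun x => u x - u' x) (fun x => v x - v' x) := by
  refine ⟨hv.1.sub hw.1, hv.2.1.sub hw.2.1, fun φ hφ => ?_⟩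
  have hl : IsTestFunction O (iterPartial l φ) := by
    clear hv hw
    induction l with
    | nil => exact hφ
    | cons i l ih => exact ih.partialDeriv i
  have hi : ∀ w χ, LocallyIntegrableOn w O → IsTestFunction O χ →
      IntegrableOn (fun x => w x * χ x) O := fun w χ hw hχ =>
    integrableOn_mul_of_hasCompactSupport hw hχ.1.continuous hχ.2.1 hχ.2.2
  simp only [sub_mul]
  rw [integral_sub (hi _ _ hv.1 hl) (hi _ _ hw.1 hl),
    integral_sub (hi _ _ hv.2.1 hφ) (hi _ _ hw.2.1 hφ), hv.2.2 φ hφ, hw.2.2 φ hφ, mul_sub]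

theorem MemHk.isWeakDeriv_weakDeriv {k : ℕ} (h : MemHk k O u) {l : List (Fin d)}
    (hl : l.length ≤ k) : IsWeakDeriv O l u (weakDeriv O l u) := by
  have hex : ∃ v, IsWeakDeriv O l u v := (h l hl).imp fun _ => And.left
  rw [weakDeriv, dif_pos hex]
  exact hex.choose_spec

theorem IsWeakDeriv.single_eq {i : Fin d} (h : IsWeakDeriv O [i] u v) (hφ : IsTestFunction O φ) :
    ∫ x in O, u x * partialDeriv i φ x = -∫ x in O, v x * φ x := by
  simpa [iterPartial] using h.2.2 φ hφ

/-- Holds because `∂ᵢφ` is again a test function. It links the first and second weak derivatives,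
which `weakDeriv` chooses independently of each other. -/
theorem IsWeakDeriv.of_pair {i : Fin d} {w : EuclideanSpace ℝ (Fin d) → ℝ}
    (h1 : IsWeakDeriv O [i] u v) (h2 : IsWeakDeriv O [i, i] u w) : IsWeakDeriv O [i] v w := by
  refine ⟨h1.2.1, h2.2.1, fun φ hφ => ?_⟩
  have e1 := h1.single_eq (hφ.partialDeriv i)
  have e2 := h2.2.2 φ hφ
  simp only [iterPartial, List.length_cons, List.length_nil] at e2 ⊢
  rw [e1] at e2
  norm_num at e2 ⊢
  linarith

theorem IsWeakDeriv.trans {i : Fin d} {w : EuclideanSpace ℝ (Fin d) → ℝ}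
    (h1 : IsWeakDeriv O [i] u v) (h2 : IsWeakDeriv O [i] v w) : IsWeakDeriv O [i, i] u w := by
  refine ⟨h1.1, h2.2.1, fun φ hφ => ?_⟩
  have e1 := h1.single_eq (hφ.partialDeriv i)
  have e2 := h2.single_eq hφ
  simp only [iterPartial, List.length_cons, List.length_nil]
  rw [e1, e2]
  ring

/-- The Leibniz rule for a weak derivative multiplied by a `C¹` function. -/
theorem IsWeakDeriv.mul (hO : IsOpen O) {i : Fin d} (h : IsWeakDeriv O [i] u v)
    (hF : ContDiffOn ℝ 1 F O) :
    IsWeakDeriv O [i] (fun x => F x * u x) (fun x => partialDeriv i F x * u x + F x * v x) := by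
  have hl := hO.isLocallyClosed
  have i1 : LocallyIntegrableOn (fun x => F x * u x) O := h.1.continuousOn_mul hF.continuousOn hl
  have i2 : LocallyIntegrableOn (fun x => partialDeriv i F x * u x) O :=
    h.1.continuousOn_mul (continuousOn_partialDeriv hO hF i) hl
  have i3 : LocallyIntegrableOn (fun x => F x * v x) O := h.2.1.continuousOn_mul hF.continuousOn hl
  refine ⟨i1, i2.add i3, fun φ hφ => ?_⟩
  have hi : ∀ w χ, LocallyIntegrableOn w O → IsTestFunction O χ →
      IntegrableOn (fun x => w x * χ x) O := fun w χ hw hχ =>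
    integrableOn_mul_of_hasCompactSupport hw hχ.1.continuous hχ.2.1 hχ.2.2
  -- The product `F φ` is only `C¹`, which is why weak derivatives had to be extended to `C¹` test
  -- functions.
  have e := weak_ibp_c1 hO i h.1 h.2.1 (fun φ hφ => h.single_eq hφ)
    (hφ.isC1TestFunction.mul hO hF)
  have e2 : ∫ x in O, u x * partialDeriv i (fun x => F x * φ x) x
      = (∫ x in O, F x * u x * partialDeriv i φ x)
        + ∫ x in O, partialDeriv i F x * u x * φ x := by
    rw [← integral_add (hi _ _ i1 (hφ.partialDeriv i)) (hi _ _ i2 hφ)]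
    refine setIntegral_congr_fun hO.measurableSet fun x hx => ?_
    rw [partialDeriv_mul ((hF.contDiffAt (hO.mem_nhds hx)).differentiableAt (by simp))
      (hφ.1.differentiable (by simp) x)]
    ring
  have e3 : ∫ x in O, v x * (F x * φ x) = ∫ x in O, F x * v x * φ x := by
    congr 1; ext x; ring
  simp only [iterPartial, List.length_cons, List.length_nil, add_mul]
  rw [integral_add (hi _ _ i2 hφ) (hi _ _ i3 hφ), zero_add, pow_one]
  linarith

/-- This is the Leibniz rule for `F` times the constant `1`. -/
theorem isWeakDeriv_partialDeriv (hO : IsOpen O) (hF : ContDiffOn ℝ 1 F O) (i : Fin d) :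
    IsWeakDeriv O [i] F (partialDeriv i F) := by
  have h1 : IsWeakDeriv O [i] (fun _ => (1 : ℝ)) (fun _ => 0) := by
    refine ⟨(locallyIntegrable_const _).locallyIntegrableOn _,
      (locallyIntegrable_const _).locallyIntegrableOn _, fun φ hφ => ?_⟩
    simpa [iterPartial] using hφ.isC1TestFunction.setIntegral_partialDeriv i
  simpa using h1.mul hO hF

/-- The weak equation `∇ · (f p) = g` holds almost everywhere in expanded form. -/
theorem HasWeakDivergence.ae_eq (hO : IsOpen O) {f g : EuclideanSpace ℝ (Fin d) → ℝ}
    {p q : Fin d → EuclideanSpace ℝ (Fin d) → ℝ} (hf : ContDiffOn ℝ 1 f O)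
    (hpq : ∀ i, IsWeakDeriv O [i] (p i) (q i))
    (h : HasWeakDivergence O (fun i x => f x * p i x) g) :
    ∀ᵐ x ∂volume.restrict O, ∑ i, (partialDeriv i f x * p i x + f x * q i x) = g x := by
  have hm := fun i => (hpq i).mul hO hf
  refine ae_eq_of_forall_testFunction hO ?_ h.2.1 fun φ hφ => ?_
  · have : ∀ s : Finset (Fin d), LocallyIntegrableOn
        (fun x => ∑ i ∈ s, (partialDeriv i f x * p i x + f x * q i x)) O := by
      intro s
      induction s using Finset.cons_induction with
      | empty => simpa using (locallyIntegrable_const (0 : ℝ)).locallyIntegrableOn O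
      | cons i s hi ih =>
        simp only [Finset.sum_cons]
        exact (hm i).2.1.add ih
    exact this _
  · have e := h.2.2 φ hφ
    rw [integral_finsetSum] at e
    · simp only [Finset.sum_mul]
      rw [integral_finsetSum]
      · simp only [(hm _).single_eq hφ, Finset.sum_neg_distrib, neg_inj] at e
        exact e
      · exact fun i _ => integrableOn_mul_of_hasCompactSupport (hm i).2.1 hφ.1.continuous
          hφ.2.1 hφ.2.2
    · exact fun i _ => integrableOn_mul_of_hasCompactSupport (hm i).1
        (hφ.partialDeriv i).1.continuous (hφ.partialDeriv i).2.1 (hφ.partialDeriv i).2.2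

/-! ### Maximum principle and coercivity. -/

/-- At a local maximum the pure second derivatives are nonpositive. -/
theorem partialDeriv_partialDeriv_nonpos_of_isLocalMax (hO : IsOpen O) (hu : ContDiffOn ℝ 2 u O)
    {x : EuclideanSpace ℝ (Fin d)} (hx : x ∈ O) (hmax : IsLocalMax u x) (i : Fin d) :
    partialDeriv i (partialDeriv i u) x ≤ 0 := by
  by_contra! hpos
  set e : EuclideanSpace ℝ (Fin d) := EuclideanSpace.single i 1 with he
  set γ : ℝ → EuclideanSpace ℝ (Fin d) := fun t => x + t • e with hγ
  have hγ0 : γ 0 = x := by simp [hγ]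
  have hγd : ∀ t, HasDerivAt γ e t := fun t => by
    have := ((hasDerivAt_id t).smul_const e).const_add x
    rwa [one_smul] at this
  have hγc : Continuous γ := by fun_prop
  have hγO : ∀ᶠ t in 𝓝 (0 : ℝ), γ t ∈ O :=
    hγc.continuousAt.eventually_mem (by rw [hγ0]; exact hO.mem_nhds hx)
  have hdiff : ∀ F : EuclideanSpace ℝ (Fin d) → ℝ, ContDiffOn ℝ 1 F O → ∀ t, γ t ∈ O →
      HasDerivAt (F ∘ γ) (partialDeriv i F (γ t)) t := fun F hF t ht =>
    ((hF.contDiffAt (hO.mem_nhds ht)).differentiableAt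
      (by simp)).hasFDerivAt.comp_hasDerivAt t (hγd t)
  have hu1 : ContDiffOn ℝ 1 u O := hu.of_le (by norm_num)
  have hd1 : deriv (u ∘ γ) =ᶠ[𝓝 0] partialDeriv i u ∘ γ :=
    hγO.mono fun t ht => (hdiff u hu1 t ht).deriv
  have h0 : γ 0 ∈ O := by rwa [hγ0]
  have hd2 : deriv (deriv (u ∘ γ)) 0 = partialDeriv i (partialDeriv i u) x := by
    rw [hd1.deriv_eq, (hdiff _ (contDiffOn_partialDeriv hO hu i) 0 h0).deriv, hγ0]
  have hmaxγ : IsLocalMax (u ∘ γ) 0 := by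
    have : Filter.Tendsto γ (𝓝 0) (𝓝 x) := by
      simpa [hγ0] using hγc.tendsto 0
    simpa [IsLocalMax, IsMaxFilter, hγ0] using this.eventually hmax
  -- A positive second derivative would make the maximum along the line also a minimum, so `u ∘ γ`
  -- would be locally constant.
  have hminγ : IsLocalMin (u ∘ γ) 0 :=
    isLocalMin_of_deriv_deriv_pos (by rw [hd2]; exact hpos) hmaxγ.deriv_eq_zero
      (hdiff u hu1 0 h0).continuousAt
  have hconst : u ∘ γ =ᶠ[𝓝 0] fun _ => (u ∘ γ) 0 := by
    filter_upwards [hmaxγ, hminγ] with t h1 h2 using le_antisymm h1 h2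
  have : deriv (deriv (u ∘ γ)) 0 = 0 := by
    rw [hconst.deriv.deriv_eq]
    simp
  linarith

/-- A maximum principle: a function with zero boundary values whose Laplacian is positive at its
critical points is negative. -/
theorem neg_of_laplacian_pos_of_critical (hO : IsOpen O) (hb : Bornology.IsBounded O)
    (hu : ContDiffOn ℝ 2 u O) (hc : ContinuousOn u (closure O)) (h0 : ∀ x ∈ frontier O, u x = 0)
    (hpos : ∀ x ∈ O, (∀ i, partialDeriv i u x = 0) →
      0 < ∑ i, partialDeriv i (partialDeriv i u) x) :
    ∀ x ∈ O, u x < 0 := by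
  have hno : ∀ y ∈ O, ¬ IsMaxOn u (closure O) y := by
    intro y hy hmax
    have hloc : IsLocalMax u y :=
      hmax.isLocalMax (Filter.mem_of_superset (hO.mem_nhds hy) subset_closure)
    refine (hpos y hy fun i => ?_).not_ge (Finset.sum_nonpos fun i _ =>
      partialDeriv_partialDeriv_nonpos_of_isLocalMax hO hu hy hloc i)
    simp [partialDeriv, hloc.fderiv_eq_zero]
  intro x hx
  by_contra! hux
  obtain ⟨y, hy, hmax⟩ := hb.isCompact_closure.exists_isMaxOn ⟨x, subset_closure hx⟩ hc
  by_cases hyO : y ∈ O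
  · exact hno y hyO hmax
  · have hy0 : u y = 0 := h0 y ⟨hy, by rwa [hO.interior_eq]⟩
    -- A maximum on the frontier has value `0 ≤ u x`, so the interior point `x` is a maximum too.
    exact hno x hx fun z hz => (hmax hz).trans (hy0.trans_le hux)

/-- A lower bound for the transport operator of `u`, where `f > 0` and `∇ · (f ∇u) ≥ gmin`. -/
theorem coercive_of_bounds {fmin gmin B a L : ℝ} {b p : Fin d → ℝ}
    (hfmin : 0 < fmin) (hgmin : 0 < gmin) (hB : 0 < B)
    (ha : fmin ≤ a) (haB : a ≤ B) (hb : ∀ i, |b i| ≤ B)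
    (h : gmin ≤ (∑ i, b i * p i) + a * L) :
    gmin / (2 * B) ≤ L + d * B ^ 2 / (2 * fmin * gmin) * ∑ i, p i ^ 2 := by
  rcases Nat.eq_zero_or_pos d with rfl | hd
  · simp only [Finset.univ_eq_empty, Finset.sum_empty, zero_add, mul_zero, add_zero] at h ⊢
    have hL : 0 < L := by
      by_contra! hL
      nlinarith
    rw [div_le_iff₀ (by positivity)]
    nlinarith
  set lam : ℝ := d * B ^ 2 / (2 * fmin * gmin) with hlam
  have hd' : (0 : ℝ) < d := by exact_mod_cast hd
  have hlam0 : 0 < lam := by positivity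
  -- Young's inequality with `gmin / 2` shared equally among the `d` coordinates; `lam` is the value
  -- that makes the difference of the two sides of `B |p i| ≤ …` a perfect square.
  have h1 : ∀ i, b i * p i ≤ lam * fmin * p i ^ 2 + gmin / (2 * d) := by
    intro i
    have e1 : b i * p i ≤ B * |p i| := by
      calc b i * p i ≤ |b i * p i| := le_abs_self _
        _ = |b i| * |p i| := abs_mul _ _
        _ ≤ B * |p i| := by gcongr; exact hb i
    have e2 : lam * fmin = d * B ^ 2 / (2 * gmin) := by rw [hlam]; field_simp
    have e3 : 0 ≤ (d * B * |p i| - gmin) ^ 2 / (2 * d * gmin) := by positivity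
    have e4 : (d * B * |p i| - gmin) ^ 2 / (2 * d * gmin)
        = lam * fmin * p i ^ 2 + gmin / (2 * d) - B * |p i| := by
      rw [e2, ← sq_abs (p i)]
      field_simp
      ring
    linarith
  have h2 : ∑ i, b i * p i ≤ lam * fmin * (∑ i, p i ^ 2) + gmin / 2 := by
    refine (Finset.sum_le_sum fun i _ => h1 i).trans_eq ?_
    rw [Finset.sum_add_distrib, ← Finset.mul_sum]
    simp
    field_simp
  set S := ∑ i, p i ^ 2 with hS
  have hS0 : 0 ≤ S := Finset.sum_nonneg fun i _ => sq_nonneg _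
  have h3 : gmin / 2 ≤ a * (L + lam * S) := by
    have : lam * fmin * S ≤ a * (lam * S) := by
      rw [show lam * fmin * S = fmin * (lam * S) by ring]
      exact mul_le_mul_of_nonneg_right ha (by positivity)
    linarith
  -- Positivity allows `a` to be replaced by its upper bound `B`.
  have h4 : 0 < L + lam * S := by
    by_contra! hL
    nlinarith
  rw [div_le_iff₀ (by positivity)]
  nlinarith

/-! ### The transport operator and its energy estimate. -/

/-- The transport operator `∇ · (h ∇u) = ∇h · ∇u + h Δu`. -/
noncomputable def transport (u h : EuclideanSpace ℝ (Fin d) → ℝ) :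
    EuclideanSpace ℝ (Fin d) → ℝ :=
  fun x => ∑ i, (partialDeriv i h x * partialDeriv i u x
    + h x * partialDeriv i (partialDeriv i u) x)

theorem continuousOn_transport (hO : IsOpen O) (hu : ContDiffOn ℝ 2 u O)
    (hh : ContDiffOn ℝ 1 h O) : ContinuousOn (transport u h) O :=
  continuousOn_finsetSum _ fun i _ =>
    ((continuousOn_partialDeriv hO hh i).mul
      (continuousOn_partialDeriv hO (hu.of_le (by norm_num)) i)).add
    (hh.continuousOn.mul (continuousOn_partialDeriv hO (contDiffOn_partialDeriv hO hu i) i))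

/-- The weighted energy estimate for the transport operator. -/
theorem weighted_energy_le (hO : IsOpen O) (hu : ContDiffOn ℝ 2 u O) (hh : ContDiffOn ℝ 1 h O)
    (hw : IsC1TestFunction O w) (hw0 : ∀ x, 0 ≤ w x) {lam c : ℝ} (hc : 0 < c)
    (hwu : ∀ x ∈ O, ∑ i, partialDeriv i w x * partialDeriv i u x
      ≤ -(lam * w x * ∑ i, partialDeriv i u x ^ 2))
    (hco : ∀ x ∈ O, c ≤ ∑ i, partialDeriv i (partialDeriv i u) x
      + lam * ∑ i, partialDeriv i u x ^ 2) :
    c ^ 2 * ∫ x in O, h x ^ 2 * w x ≤ 4 * ∫ x in O, transport u h x ^ 2 * w x := by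
  have hF : ∀ i, ContDiffOn ℝ 1 (fun x => h x * h x * partialDeriv i u x) O := fun i =>
    (hh.mul hh).mul (contDiffOn_partialDeriv hO hu i)
  have hΦ : ∀ i, IsC1TestFunction O (fun x => h x * h x * partialDeriv i u x * w x) := fun i =>
    hw.mul hO (hF i)
  have hint : ∀ G : EuclideanSpace ℝ (Fin d) → ℝ, ContinuousOn G O →
      IntegrableOn (fun x => G x * w x) O := fun G hG =>
    integrableOn_mul_of_hasCompactSupport (hG.locallyIntegrableOn hO.measurableSet)
      hw.contDiff.continuous hw.hasCompactSupport hw.tsupport_subset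
  have i1 := hint _ (hh.continuousOn.pow 2)
  have i2 := hint _ ((continuousOn_transport hO hu hh).pow 2)
  have i3 : ∀ i, IntegrableOn
      (partialDeriv i (fun x => h x * h x * partialDeriv i u x * w x)) O := fun i =>
    (((hΦ i).continuous_partialDeriv i).integrable_of_hasCompactSupport
      (hasCompactSupport_partialDeriv i (hΦ i).hasCompactSupport)).integrableOn
  have hdiv : ∫ x in O, ∑ i, partialDeriv i (fun x => h x * h x * partialDeriv i u x * w x) x
      = 0 := by
    rw [integral_finsetSum _ fun i _ => i3 i]
    exact Finset.sum_eq_zero fun i _ => (hΦ i).setIntegral_partialDeriv i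
  -- The divergence is at most `2 h w T h - c h² w`. The factor `2 * c` turns this into the square
  -- `(c h - 2 T h)² w ≥ 0`.
  have hpt : ∀ x ∈ O, c ^ 2 * (h x ^ 2 * w x)
      + 2 * c * ∑ i, partialDeriv i (fun x => h x * h x * partialDeriv i u x * w x) x
      ≤ 4 * (transport u h x ^ 2 * w x) := by
    intro x hx
    have hhd : DifferentiableAt ℝ h x :=
      (hh.contDiffAt (hO.mem_nhds hx)).differentiableAt (by simp)
    have hud : ∀ i, DifferentiableAt ℝ (partialDeriv i u) x := fun i =>
      ((contDiffOn_partialDeriv hO hu i).contDiffAt (hO.mem_nhds hx)).differentiableAt (by simp)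
    have hwd : DifferentiableAt ℝ w x := hw.contDiff.differentiable (by simp) x
    have e1 : ∑ i, partialDeriv i (fun x => h x * h x * partialDeriv i u x * w x) x
        = h x ^ 2 * ∑ i, partialDeriv i w x * partialDeriv i u x
          + 2 * h x * w x * transport u h x
          - h x ^ 2 * w x * ∑ i, partialDeriv i (partialDeriv i u) x := by
      simp only [transport, Finset.mul_sum, ← Finset.sum_add_distrib, ← Finset.sum_sub_distrib]
      refine Finset.sum_congr rfl fun i _ => ?_
      rw [partialDeriv_mul ((hhd.fun_mul hhd).fun_mul (hud i)) hwd,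
        partialDeriv_mul (hhd.fun_mul hhd) (hud i), partialDeriv_mul hhd hhd]
      ring
    rw [e1]
    have a1 := mul_le_mul_of_nonneg_left (hwu x hx) (sq_nonneg (h x))
    have a2 := mul_le_mul_of_nonneg_left (hco x hx)
      (mul_nonneg (sq_nonneg (h x)) (hw0 x))
    have a3 : 0 ≤ (c * h x - 2 * transport u h x) ^ 2 * w x :=
      mul_nonneg (sq_nonneg _) (hw0 x)
    have a4 := mul_le_mul_of_nonneg_left (add_le_add a1 a2) (by positivity : 0 ≤ 2 * c)
    linarith
  have := setIntegral_mono_on ((i1.const_mul (c ^ 2)).add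
    ((integrable_finsetSum _ fun i _ => i3 i).const_mul (2 * c))) (i2.const_mul 4)
    hO.measurableSet hpt
  simp only [Pi.add_apply] at this
  rw [integral_add (i1.const_mul _) ((integrable_finsetSum _ fun i _ => i3 i).const_mul _),
    integral_const_mul, integral_const_mul, integral_const_mul, hdiv,
    mul_zero, add_zero] at this
  exact this

/-- A decreasing cutoff of `exp (-lam s)` that vanishes for `s ≥ -1 / n`. -/
noncomputable def cutoffWeight (lam : ℝ) (n : ℕ) (s : ℝ) : ℝ :=
  Real.exp (-lam * s) * Real.smoothTransition (-(n * s) - 1)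

theorem contDiff_cutoffWeight (lam : ℝ) (n : ℕ) : ContDiff ℝ 1 (cutoffWeight lam n) := by
  have : ContDiff ℝ 1 Real.smoothTransition := Real.smoothTransition.contDiff (n := 1)
  unfold cutoffWeight
  fun_prop

theorem cutoffWeight_nonneg (lam : ℝ) (n : ℕ) (s : ℝ) : 0 ≤ cutoffWeight lam n s :=
  mul_nonneg (Real.exp_nonneg _) (Real.smoothTransition.nonneg _)

theorem cutoffWeight_le (lam : ℝ) (n : ℕ) (s : ℝ) :
    cutoffWeight lam n s ≤ Real.exp (-lam * s) :=
  mul_le_of_le_one_right (Real.exp_nonneg _) (Real.smoothTransition.le_one _)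

/-- The exponential factor alone would give equality; the smooth transition is decreasing in `s` and
can only lower the derivative. This one-sided bound replaces a boundary condition on `h`. -/
theorem deriv_cutoffWeight_le (lam : ℝ) (n : ℕ) (s : ℝ) :
    deriv (cutoffWeight lam n) s ≤ -(lam * cutoffWeight lam n s) := by
  have hd : Differentiable ℝ Real.smoothTransition :=
    (Real.smoothTransition.contDiff (n := 1)).differentiable (by simp)
  have h1 : HasDerivAt (fun s : ℝ => Real.exp (-lam * s)) (Real.exp (-lam * s) * -lam) s := by
    simpa using ((hasDerivAt_id s).const_mul (-lam)).exp
  have hin : HasDerivAt (fun s : ℝ => -(n * s) - 1) (-(n : ℝ)) s := by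
    simpa using (((hasDerivAt_id s).const_mul (n : ℝ)).neg).sub_const 1
  have h2 := (hd (-(n * s) - 1)).hasDerivAt.comp s hin
  have h3 := (h1.mul h2).deriv
  have h4 : 0 ≤ deriv Real.smoothTransition (-(n * s) - 1) :=
    Real.smoothTransition.monotone.deriv_nonneg
  have h5 : deriv (cutoffWeight lam n) s
      = Real.exp (-lam * s) * -lam * Real.smoothTransition (-(n * s) - 1)
        + Real.exp (-lam * s) * (deriv Real.smoothTransition (-(n * s) - 1) * -(n : ℝ)) := h3
  rw [h5, cutoffWeight]
  have : 0 ≤ Real.exp (-lam * s) * (deriv Real.smoothTransition (-(n * s) - 1) * n) := by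
    positivity
  linarith

theorem cutoffWeight_eq_zero {lam : ℝ} {n : ℕ} {s : ℝ} (hs : -1 ≤ n * s) :
    cutoffWeight lam n s = 0 := by
  rw [cutoffWeight, Real.smoothTransition.zero_of_nonpos (by linarith), mul_zero]

theorem tendsto_cutoffWeight (lam : ℝ) {s : ℝ} (hs : s < 0) :
    Filter.Tendsto (fun n => cutoffWeight lam n s) Filter.atTop (𝓝 (Real.exp (-lam * s))) := by
  -- From `n ≥ 2 / -s` on, the argument `-(n * s) - 1` is at least `1`, so the sequence is
  -- eventually constant.
  obtain ⟨N, hN⟩ := exists_nat_ge (2 / -s)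
  refine tendsto_const_nhds.congr' ?_
  filter_upwards [Filter.eventually_ge_atTop N] with n hn
  have h1 : 2 / -s ≤ n := hN.trans (by exact_mod_cast hn)
  rw [div_le_iff₀ (by linarith)] at h1
  rw [cutoffWeight, Real.smoothTransition.one_of_one_le (by linarith), mul_one]

/-- Composing a cutoff with a negative function with zero boundary values gives a test function. -/
theorem isC1TestFunction_cutoffWeight (hO : IsOpen O) (hb : Bornology.IsBounded O)
    (hu : ContDiffOn ℝ 2 u O) (hc : ContinuousOn u (closure O)) (h0 : ∀ x ∈ frontier O, u x = 0)
    (lam : ℝ) (n : ℕ) :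
    IsC1TestFunction O (O.indicator fun x => cutoffWeight lam n (u x)) := by
  -- On this set `u` is bounded away from its boundary value `0`, so the set lies in `O`; for `n =
  -- 0` it is empty.
  have hK : IsCompact (closure O ∩ u ⁻¹' {s | n * s ≤ -1}) :=
    hb.isCompact_closure.of_isClosed_subset
      (hc.preimage_isClosed_of_isClosed isClosed_closure
        (isClosed_le (by fun_prop) (by fun_prop))) Set.inter_subset_left
  refine .of_support_subset hO ?_ hK ?_ ?_
  · refine ((contDiff_cutoffWeight lam n).comp_contDiffOn (hu.of_le (by norm_num))).congr ?_
    intro x hx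
    simp [hx]
  · intro x hx
    by_contra hxO
    have := h0 x ⟨hx.1, by rwa [hO.interior_eq]⟩
    have h2 : (n : ℝ) * u x ≤ -1 := hx.2
    rw [this] at h2
    norm_num at h2
  · intro x hx
    have hxO : x ∈ O := Set.mem_of_indicator_ne_zero hx
    refine ⟨subset_closure hxO, ?_⟩
    by_contra! hlt
    refine hx ?_
    rw [Set.indicator_of_mem hxO]
    exact cutoffWeight_eq_zero (not_le.1 hlt).le

/-- The `L²` stability estimate for the transport operator, without boundary conditions on `h`. -/
theorem energy_le (hO : IsOpen O) (hb : Bornology.IsBounded O)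
    (hu : ContDiffOn ℝ 2 u O) (hc : ContinuousOn u (closure O)) (h0 : ∀ x ∈ frontier O, u x = 0)
    (hneg : ∀ x ∈ O, u x < 0) {B : ℝ} (huB : ∀ x ∈ O, -B ≤ u x) (hh : ContDiffOn ℝ 1 h O)
    {lam c : ℝ} (hlam : 0 ≤ lam) (hcpos : 0 < c)
    (hco : ∀ x ∈ O, c ≤ ∑ i, partialDeriv i (partialDeriv i u) x
      + lam * ∑ i, partialDeriv i u x ^ 2)
    (hhL : IntegrableOn (fun x => h x ^ 2) O)
    (hTL : IntegrableOn (fun x => transport u h x ^ 2) O) :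
    c ^ 2 * ∫ x in O, h x ^ 2 ≤ 4 * (Real.exp (lam * B) * ∫ x in O, transport u h x ^ 2) := by
  set w : ℕ → EuclideanSpace ℝ (Fin d) → ℝ :=
    fun n => O.indicator fun x => cutoffWeight lam n (u x) with hw
  have hwt : ∀ n, IsC1TestFunction O (w n) := fun n =>
    isC1TestFunction_cutoffWeight hO hb hu hc h0 lam n
  have hw0 : ∀ n x, 0 ≤ w n x := fun n x =>
    Set.indicator_nonneg (fun _ _ => cutoffWeight_nonneg _ _ _) x
  have hwle : ∀ n, ∀ x ∈ O, w n x ≤ Real.exp (lam * B) := by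
    intro n x hx
    simp only [hw, Set.indicator_of_mem hx]
    refine (cutoffWeight_le _ _ _).trans (Real.exp_le_exp.2 ?_)
    nlinarith [huB x hx]
  have hwu : ∀ n, ∀ x ∈ O, ∑ i, partialDeriv i (w n) x * partialDeriv i u x
      ≤ -(lam * w n x * ∑ i, partialDeriv i u x ^ 2) := by
    intro n x hx
    have hev : w n =ᶠ[𝓝 x] fun x => cutoffWeight lam n (u x) := by
      filter_upwards [hO.mem_nhds hx] with y hy using Set.indicator_of_mem hy _
    have hud : HasFDerivAt u (fderiv ℝ u x) x :=
      ((hu.contDiffAt (hO.mem_nhds hx)).differentiableAt (by simp)).hasFDerivAt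
    have hfd := ((contDiff_cutoffWeight lam n).differentiable (by simp)
      (u x)).hasDerivAt.comp_hasFDerivAt x hud
    have hp : ∀ i, partialDeriv i (w n) x
        = deriv (cutoffWeight lam n) (u x) * partialDeriv i u x := by
      intro i
      have : fderiv ℝ (w n) x = deriv (cutoffWeight lam n) (u x) • fderiv ℝ u x := by
        rw [hev.fderiv_eq]
        exact hfd.fderiv
      simp [partialDeriv, this]
    have e : ∑ i, partialDeriv i (w n) x * partialDeriv i u x
        = deriv (cutoffWeight lam n) (u x) * ∑ i, partialDeriv i u x ^ 2 := by
      rw [Finset.mul_sum]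
      exact Finset.sum_congr rfl fun i _ => by rw [hp]; ring
    rw [e, hev.self_of_nhds, ← neg_mul]
    exact mul_le_mul_of_nonneg_right (deriv_cutoffWeight_le _ _ _)
      (Finset.sum_nonneg fun _ _ => sq_nonneg _)
  have hn : ∀ n, c ^ 2 * ∫ x in O, h x ^ 2 * w n x
      ≤ 4 * (Real.exp (lam * B) * ∫ x in O, transport u h x ^ 2) := by
    intro n
    refine (weighted_energy_le hO hu hh (hwt n) (hw0 n) hcpos (hwu n) hco).trans ?_
    refine mul_le_mul_of_nonneg_left ?_ (by norm_num)
    rw [← integral_const_mul]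
    refine integral_mono_of_nonneg (.of_forall fun x => mul_nonneg (sq_nonneg _) (hw0 n x))
      (hTL.const_mul _) ?_
    filter_upwards [ae_restrict_mem hO.measurableSet] with x hx
    rw [mul_comm]
    exact mul_le_mul_of_nonneg_right (hwle n x hx) (sq_nonneg _)
  have hbound : ∀ n, ∀ᵐ x ∂volume.restrict O,
      ‖h x ^ 2 * w n x‖ ≤ Real.exp (lam * B) * h x ^ 2 := by
    intro n
    filter_upwards [ae_restrict_mem hO.measurableSet] with x hx
    rw [Real.norm_of_nonneg (mul_nonneg (sq_nonneg _) (hw0 n x)), mul_comm]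
    exact mul_le_mul_of_nonneg_right (hwle n x hx) (sq_nonneg _)
  have hlimpt : ∀ x ∈ O, Filter.Tendsto (fun n => h x ^ 2 * w n x) Filter.atTop
      (𝓝 (h x ^ 2 * Real.exp (-lam * u x))) := by
    intro x hx
    simp only [hw, Set.indicator_of_mem hx]
    exact (tendsto_cutoffWeight lam (hneg x hx)).const_mul _
  have hmeas : ∀ n, AEStronglyMeasurable (fun x => h x ^ 2 * w n x) (volume.restrict O) := fun n =>
    hhL.aestronglyMeasurable.mul (hwt n).contDiff.continuous.aestronglyMeasurable
  have hlim := tendsto_integral_of_dominated_convergence _ hmeas (hhL.const_mul _) hbound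
    ((ae_restrict_mem hO.measurableSet).mono hlimpt)
  have hle := le_of_tendsto' (hlim.const_mul (c ^ 2)) hn
  -- The limit weight `exp (-lam u)` is at least `1`, since `u < 0` and `lam ≥ 0`.
  refine le_trans (mul_le_mul_of_nonneg_left ?_ (sq_nonneg c)) hle
  refine setIntegral_mono_on hhL ?_ hO.measurableSet fun x hx => ?_
  · refine (hhL.const_mul (Real.exp (lam * B))).mono'
      (aestronglyMeasurable_of_tendsto_ae _ hmeas
        ((ae_restrict_mem hO.measurableSet).mono hlimpt)) ?_
    filter_upwards [ae_restrict_mem hO.measurableSet] with x hx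
    rw [Real.norm_of_nonneg (by positivity), mul_comm]
    refine mul_le_mul_of_nonneg_right (Real.exp_le_exp.2 ?_) (sq_nonneg _)
    nlinarith [huB x hx]
  · refine le_mul_of_one_le_right (sq_nonneg _) (Real.one_le_exp ?_)
    nlinarith [hneg x hx]

/-! ### Norm comparisons and the bound of the transport term by the data. -/

theorem enorm_iterPartial_le_ckNorm {k : ℕ} {l : List (Fin d)} (hl : l.length ≤ k)
    {x : EuclideanSpace ℝ (Fin d)} (hx : x ∈ O) : ‖iterPartial l u x‖ₑ ≤ ckNorm k O u :=
  le_iSup₂_of_le l hl (le_iSup₂_of_le (f := fun x (_ : x ∈ O) => ‖iterPartial l u x‖ₑ) x hx le_rfl)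

theorem abs_iterPartial_le_of_ckNorm_le {k : ℕ} {B : ℝ} (hB : 0 ≤ B)
    (h : ckNorm k O u ≤ ENNReal.ofReal B) {l : List (Fin d)} (hl : l.length ≤ k)
    {x : EuclideanSpace ℝ (Fin d)} (hx : x ∈ O) : |iterPartial l u x| ≤ B := by
  have := (enorm_iterPartial_le_ckNorm hl hx).trans h
  rwa [Real.enorm_eq_ofReal_abs, ENNReal.ofReal_le_ofReal_iff hB] at this

theorem l2Norm_weakDeriv_le_hkNorm {k n : ℕ} (hn : n ≤ k) (ι : Fin n → Fin d) :
    l2Norm O (weakDeriv O (List.ofFn ι) u) ≤ hkNorm k O u := by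
  have h1 : l2Norm O (weakDeriv O (List.ofFn ι) u) ^ 2
      ≤ ∑ n ∈ Finset.range (k + 1), ∑ ι : Fin n → Fin d,
        l2Norm O (weakDeriv O (List.ofFn ι) u) ^ 2 :=
    (Finset.single_le_sum
      (f := fun ι : Fin n → Fin d => l2Norm O (weakDeriv O (List.ofFn ι) u) ^ 2)
      (fun _ _ => zero_le) (Finset.mem_univ ι)).trans
    (Finset.single_le_sum
      (f := fun n => ∑ ι : Fin n → Fin d, l2Norm O (weakDeriv O (List.ofFn ι) u) ^ 2)
      (fun _ _ => zero_le) (Finset.mem_range.2 (Nat.lt_succ_of_le hn)))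
  have h2 := ENNReal.rpow_le_rpow h1 (by norm_num : (0 : ℝ) ≤ 1 / 2)
  rwa [← ENNReal.rpow_natCast, ← ENNReal.rpow_mul, Nat.cast_ofNat,
    show (2 : ℝ) * (1 / 2) = 1 by norm_num, ENNReal.rpow_one] at h2

theorem MemHk.sub {k : ℕ} (hu : MemHk k O u) (hv : MemHk k O v) :
    MemHk k O (fun x => u x - v x) := by
  intro l hl
  obtain ⟨a, ha, ha'⟩ := hu l hl
  obtain ⟨b, hb, hb'⟩ := hv l hl
  exact ⟨_, ha.sub hb, ha'.sub hb'⟩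

theorem MemHk.weakDeriv_sub (hO : IsOpen O) {k : ℕ} (hu : MemHk k O u) (hv : MemHk k O v)
    {l : List (Fin d)} (hl : l.length ≤ k) :
    weakDeriv O l (fun x => u x - v x) =ᵐ[volume.restrict O]
      fun x => weakDeriv O l u x - weakDeriv O l v x :=
  ((hu.sub hv).isWeakDeriv_weakDeriv hl).ae_unique hO
    ((hu.isWeakDeriv_weakDeriv hl).sub (hv.isWeakDeriv_weakDeriv hl))

/-- The expanded form of `∇ · (f ∇u) = g` for `u ∈ H²` and `f ∈ C¹`. -/
theorem SolvesDarcy.ae_eq (hO : IsOpen O) {f g : EuclideanSpace ℝ (Fin d) → ℝ}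
    (hf : ContDiffOn ℝ 1 f O) (hu : MemHk 2 O u) (h : SolvesDarcy O f u g) :
    ∀ᵐ x ∂volume.restrict O, ∑ i, (partialDeriv i f x * weakDeriv O [i] u x
      + f x * weakDeriv O [i, i] u x) = g x :=
  HasWeakDivergence.ae_eq hO hf (fun i =>
    (hu.isWeakDeriv_weakDeriv (l := [i]) (by simp)).of_pair
      (hu.isWeakDeriv_weakDeriv (l := [i, i]) (by simp))) h

/-- Weak derivatives of a `C²` function are the classical ones. -/
theorem weakDeriv_ae_eq_partialDeriv (hO : IsOpen O) (hu : MemHk 2 O u)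
    (hu2 : ContDiffOn ℝ 2 u O) : ∀ᵐ x ∂volume.restrict O, ∀ i,
      weakDeriv O [i] u x = partialDeriv i u x ∧
      weakDeriv O [i, i] u x = partialDeriv i (partialDeriv i u) x := by
  have h1 := fun i => isWeakDeriv_partialDeriv hO (hu2.of_le (by norm_num)) i
  have h2 := fun i => isWeakDeriv_partialDeriv hO (contDiffOn_partialDeriv hO hu2 i) i
  refine ae_all_iff.2 fun i => ?_
  exact ((hu.isWeakDeriv_weakDeriv (l := [i]) (by simp)).ae_unique hO (h1 i)).and
    ((hu.isWeakDeriv_weakDeriv (l := [i, i]) (by simp)).ae_unique hO ((h1 i).trans (h2 i)))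

theorem l2Norm_eq_ofReal_sqrt (h : MemL2 O u) :
    l2Norm O u = ENNReal.ofReal (√(∫ x in O, u x ^ 2)) := by
  rw [l2Norm, h.eLpNorm_eq_integral_rpow_norm (by norm_num) (by norm_num), Real.sqrt_eq_rpow]
  simp

theorem MemCk.memL2 (hO : IsOpen O) (hb : Bornology.IsBounded O) {k : ℕ} (h : MemCk k O u) :
    MemL2 O u := by
  have : IsFiniteMeasure (volume.restrict O) := ⟨by simpa using hb.measure_lt_top⟩
  refine MemLp.of_bound (h.1.continuousOn.aestronglyMeasurable hO.measurableSet)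
    (ckNorm k O u).toReal ?_
  filter_upwards [ae_restrict_mem hO.measurableSet] with x hx
  have := enorm_iterPartial_le_ckNorm (u := u) (l := []) (Nat.zero_le k) hx
  rw [← toReal_enorm]
  exact ENNReal.toReal_mono h.2.ne this

theorem l2Norm_leibniz_le (hO : IsOpen O) {f p q : EuclideanSpace ℝ (Fin d) → ℝ} {M : ℝ≥0∞}
    (hp : l2Norm O p ≤ M) (hq : l2Norm O q ≤ M)
    (hpm : AEStronglyMeasurable p (volume.restrict O))
    (hqm : AEStronglyMeasurable q (volume.restrict O))
    (hf : ContDiffOn ℝ 1 f O) (i : Fin d) :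
    AEStronglyMeasurable (fun x => partialDeriv i f x * p x + f x * q x) (volume.restrict O) ∧
    l2Norm O (fun x => partialDeriv i f x * p x + f x * q x) ≤ 2 * (ckNorm 1 O f * M) := by
  have m1 : AEStronglyMeasurable (fun x => partialDeriv i f x * p x) (volume.restrict O) :=
    ((continuousOn_partialDeriv hO hf i).aestronglyMeasurable hO.measurableSet).mul hpm
  have m2 : AEStronglyMeasurable (fun x => f x * q x) (volume.restrict O) :=
    (hf.continuousOn.aestronglyMeasurable hO.measurableSet).mul hqm
  refine ⟨m1.add m2, (eLpNorm_add_le m1 m2 (by norm_num)).trans ?_⟩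
  rw [two_mul]
  refine add_le_add ?_ ?_
  · refine (eLpNorm_le_mul_eLpNorm_of_ae_le_mul'' 2 hpm ?_).trans (mul_le_mul_right hp _)
    filter_upwards [ae_restrict_mem hO.measurableSet] with x hx
    rw [enorm_mul]
    exact mul_le_mul_left (enorm_iterPartial_le_ckNorm (l := [i]) (by simp) hx) _
  · refine (eLpNorm_le_mul_eLpNorm_of_ae_le_mul'' 2 hqm ?_).trans (mul_le_mul_right hq _)
    filter_upwards [ae_restrict_mem hO.measurableSet] with x hx
    rw [enorm_mul]
    exact mul_le_mul_left (enorm_iterPartial_le_ckNorm (l := []) (by simp) hx) _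

theorem partialDeriv_sub (hO : IsOpen O) (hu : ContDiffOn ℝ 1 u O) (hv : ContDiffOn ℝ 1 v O)
    {x : EuclideanSpace ℝ (Fin d)} (hx : x ∈ O) (i : Fin d) :
    partialDeriv i (fun x => u x - v x) x = partialDeriv i u x - partialDeriv i v x := by
  simp [partialDeriv, fderiv_fun_sub ((hu.contDiffAt (hO.mem_nhds hx)).differentiableAt (by simp))
    ((hv.contDiffAt (hO.mem_nhds hx)).differentiableAt (by simp))]

/-- The transport operator applied to a difference of coefficients is controlled by the data. -/
theorem l2Norm_transport_sub_le (hO : IsOpen O)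
    (hu₁ : MemHk 2 O u₁) (hu₂ : MemHk 2 O u₂) (hf₁ : ContDiffOn ℝ 1 f₁ O)
    (hf₂ : ContDiffOn ℝ 1 f₂ O) (hg₁ : MemL2 O g₁) (hg₂ : MemL2 O g₂)
    (h₁ : SolvesDarcy O f₁ u₁ g₁) (h₂ : SolvesDarcy O f₂ u₂ g₂) (hu : ContDiffOn ℝ 2 u₁ O) :
    l2Norm O (transport u₁ (fun x => f₁ x - f₂ x)) ≤
      (1 + 2 * d) * (ckNorm 1 O f₂ * hkNorm 2 O (fun x => u₁ x - u₂ x)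
        + l2Norm O (fun x => g₁ x - g₂ x)) := by
  set v : EuclideanSpace ℝ (Fin d) → ℝ := fun x => u₁ x - u₂ x with hv
  have hvH : MemHk 2 O v := hu₁.sub hu₂
  set R : Fin d → EuclideanSpace ℝ (Fin d) → ℝ := fun i x =>
    partialDeriv i f₂ x * weakDeriv O [i] v x + f₂ x * weakDeriv O [i, i] v x with hR
  -- Here `∑ i, R i` is `∇ · (f₂ ∇(u₁ - u₂))` in expanded form, so only first and pure second
  -- derivatives of `u₁ - u₂` occur.
  have hae : transport u₁ (fun x => f₁ x - f₂ x) =ᵐ[volume.restrict O]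
      (fun x => g₁ x - g₂ x) - ∑ i, R i := by
    have hv1 : ∀ᵐ x ∂volume.restrict O, ∀ i,
        weakDeriv O [i] v x = weakDeriv O [i] u₁ x - weakDeriv O [i] u₂ x ∧
        weakDeriv O [i, i] v x = weakDeriv O [i, i] u₁ x - weakDeriv O [i, i] u₂ x :=
      ae_all_iff.2 fun i => (hu₁.weakDeriv_sub hO hu₂ (l := [i]) (by simp)).and
        (hu₁.weakDeriv_sub hO hu₂ (l := [i, i]) (by simp))
    filter_upwards [hv1, h₁.ae_eq hO hf₁ hu₁, h₂.ae_eq hO hf₂ hu₂,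
      weakDeriv_ae_eq_partialDeriv hO hu₁ hu, ae_restrict_mem hO.measurableSet]
      with x e1 e2 e3 e4 hx
    simp only [Pi.sub_apply, Finset.sum_apply, ← e2, ← e3, transport, hR]
    rw [← Finset.sum_sub_distrib, ← Finset.sum_sub_distrib]
    refine Finset.sum_congr rfl fun i _ => ?_
    rw [partialDeriv_sub hO hf₁ hf₂ hx, (e1 i).1, (e1 i).2, (e4 i).1, (e4 i).2]
    ring
  have hRb : ∀ i, AEStronglyMeasurable (R i) (volume.restrict O) ∧
      l2Norm O (R i) ≤ 2 * (ckNorm 1 O f₂ * hkNorm 2 O v) := fun i =>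
    l2Norm_leibniz_le hO (l2Norm_weakDeriv_le_hkNorm (by norm_num) ![i])
      (l2Norm_weakDeriv_le_hkNorm le_rfl ![i, i])
      (hvH.isWeakDeriv_weakDeriv (l := [i]) (by simp)).2.1.aestronglyMeasurable
      (hvH.isWeakDeriv_weakDeriv (l := [i, i]) (by simp)).2.1.aestronglyMeasurable hf₂ i
  rw [l2Norm, eLpNorm_congr_ae hae]
  refine (eLpNorm_sub_le (hg₁.sub hg₂).aestronglyMeasurable
    (Finset.aestronglyMeasurable_sum _ fun i _ => (hRb i).1) (by norm_num)).trans ?_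
  have hs : eLpNorm (∑ i, R i) 2 (volume.restrict O)
      ≤ 2 * d * (ckNorm 1 O f₂ * hkNorm 2 O v) := by
    refine (eLpNorm_sum_le (fun i _ => (hRb i).1) (by norm_num)).trans
      ((Finset.sum_le_sum fun i _ => (hRb i).2).trans_eq ?_)
    simp
    ring
  set Y := ckNorm 1 O f₂ * hkNorm 2 O v
  set Z := l2Norm O (fun x => g₁ x - g₂ x) with hZ
  calc _ ≤ Z + 2 * d * Y := add_le_add le_rfl hs
    _ ≤ (Z + Y) + 2 * d * (Y + Z) := by gcongr <;> exact le_self_add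
    _ = (1 + 2 * d) * (Y + Z) := by ring

end Darcy

/-! ### Assembly of the stability estimate. -/

theorem mainTheorem4 (d : ℕ) (hd : 1 ≤ d) (O : Set (EuclideanSpace ℝ (Fin d)))
    (hO : Darcy.IsSmoothBoundedDomain O)
    (fmin gmin : ℝ) (hfmin : 0 < fmin) (hgmin : 0 < gmin) (B : ℝ) (hB : 0 < B) :
    ∃ C : ℝ≥0, 0 < C ∧
      ∀ u₁ u₂ f₁ f₂ g₁ g₂ : EuclideanSpace ℝ (Fin d) → ℝ,
        Darcy.MemHk 2 O u₁ → Darcy.MemHk 2 O u₂ →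
        Darcy.MemCk 1 O f₁ → Darcy.MemCk 1 O f₂ →
        Darcy.MemL2 O g₁ → Darcy.MemL2 O g₂ →
        Darcy.SolvesDarcy O f₁ u₁ g₁ → Darcy.SolvesDarcy O f₂ u₂ g₂ →
        Darcy.MemCk 2 O u₁ → ContinuousOn u₁ (closure O) → ContinuousOn g₁ O →
        (∀ x ∈ O, fmin ≤ f₁ x) → (∀ x ∈ O, gmin ≤ g₁ x) → (∀ x ∈ frontier O, u₁ x = 0) →
        max (Darcy.ckNorm 1 O f₁) (Darcy.ckNorm 2 O u₁) ≤ ENNReal.ofReal B →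
        Darcy.l2Norm O (fun x => f₁ x - f₂ x) ≤
          C * (Darcy.ckNorm 1 O f₂ * Darcy.hkNorm 2 O (fun x => u₁ x - u₂ x)
            + Darcy.l2Norm O (fun x => g₁ x - g₂ x)) := by
  open Darcy in
  set lam : ℝ := d * B ^ 2 / (2 * fmin * gmin) with hlam
  set c : ℝ := gmin / (2 * B) with hc
  have hlam0 : 0 ≤ lam := by positivity
  have hc0 : 0 < c := by positivity
  -- `K` is the constant of `energy_le` after taking square roots; the factor `1 + 2 * d` below
  -- comes from `l2Norm_transport_sub_le`.
  set K : ℝ := √(4 * Real.exp (lam * B) / c ^ 2) with hK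
  have hK0 : 0 < K := Real.sqrt_pos.2 (by positivity)
  refine ⟨K.toNNReal * (1 + 2 * d), by positivity, ?_⟩
  intro u₁ u₂ f₁ f₂ g₁ g₂ hu₁ hu₂ hf₁ hf₂ hg₁ hg₂ h₁ h₂ hu hcl hgc hfl hgl h0 hmax
  have hOo := hO.isOpen
  have hf₁B := (le_max_left _ _).trans hmax
  have hu₁B := (le_max_right _ _).trans hmax
  have hu2 : ContDiffOn ℝ 2 u₁ O := hu.1
  have hf1 : ContDiffOn ℝ 1 f₁ O := hf₁.1
  have hf2 : ContDiffOn ℝ 1 f₂ O := hf₂.1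
  -- Continuity of `g₁` upgrades the almost everywhere equation to every point, as the maximum
  -- principle at critical points requires.
  have hg : ∀ x ∈ O, g₁ x = transport u₁ f₁ x := by
    have hae : g₁ =ᵐ[volume.restrict O] transport u₁ f₁ := by
      filter_upwards [h₁.ae_eq hOo hf1 hu₁, weakDeriv_ae_eq_partialDeriv hOo hu₁ hu2] with x e1 e2
      rw [← e1, transport]
      exact Finset.sum_congr rfl fun i _ => by rw [(e2 i).1, (e2 i).2]
    exact Measure.eqOn_open_of_ae_eq hae hOo hgc (continuousOn_transport hOo hu2 hf1)
  have hgt : ∀ x ∈ O, gmin ≤ (∑ i, partialDeriv i f₁ x * partialDeriv i u₁ x)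
      + f₁ x * ∑ i, partialDeriv i (partialDeriv i u₁) x := by
    intro x hx
    rw [Finset.mul_sum, ← Finset.sum_add_distrib]
    exact (hgl x hx).trans_eq (hg x hx)
  have hneg : ∀ x ∈ O, u₁ x < 0 := by
    refine neg_of_laplacian_pos_of_critical hOo hO.isBounded hu2 hcl h0 fun x hx hcrit => ?_
    have e := hgt x hx
    simp only [hcrit, mul_zero, Finset.sum_const_zero, zero_add] at e
    exact pos_of_mul_pos_right (hgmin.trans_le e) (hfmin.le.trans (hfl x hx))
  have hco : ∀ x ∈ O, c ≤ ∑ i, partialDeriv i (partialDeriv i u₁) x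
      + lam * ∑ i, partialDeriv i u₁ x ^ 2 := fun x hx =>
    coercive_of_bounds hfmin hgmin hB (hfl x hx)
      ((le_abs_self _).trans
        (abs_iterPartial_le_of_ckNorm_le hB.le hf₁B (l := []) (by simp) hx))
      (fun i => abs_iterPartial_le_of_ckNorm_le hB.le hf₁B (l := [i]) (by simp) hx) (hgt x hx)
  have hlow : ∀ x ∈ O, -B ≤ u₁ x := fun x hx =>
    (abs_le.1 (abs_iterPartial_le_of_ckNorm_le hB.le hu₁B (l := []) (by simp) hx)).1
  have hhL : MemL2 O (fun x => f₁ x - f₂ x) :=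
    (hf₁.memL2 hOo hO.isBounded).sub (hf₂.memL2 hOo hO.isBounded)
  have hT := l2Norm_transport_sub_le hOo hu₁ hu₂ hf1 hf2 hg₁ hg₂ h₁ h₂ hu2
  set Y := ckNorm 1 O f₂ * hkNorm 2 O (fun x => u₁ x - u₂ x)
    + l2Norm O (fun x => g₁ x - g₂ x) with hY
  have hcoe : ((K.toNNReal * (1 + 2 * d) : ℝ≥0) : ℝ≥0∞) = ENNReal.ofReal K * (1 + 2 * d) := by
    push_cast
    rfl
  rw [hcoe]
  -- An infinite right side is trivial, as its constant is nonzero; a finite one puts the transport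
  -- term in `L²`, so that `energy_le` applies to genuine integrals.
  by_cases hYtop : Y = ⊤
  · rw [hYtop, ENNReal.mul_top]
    · exact le_top
    · exact mul_ne_zero (by simpa using hK0) (by simp)
  have hTL : MemL2 O (transport u₁ (fun x => f₁ x - f₂ x)) :=
    ⟨(continuousOn_transport hOo hu2 (hf1.sub hf2)).aestronglyMeasurable hOo.measurableSet,
      hT.trans_lt (ENNReal.mul_lt_top (by finiteness) (Ne.lt_top hYtop))⟩
  have hen := energy_le hOo hO.isBounded hu2 hcl h0 hneg hlow (hf1.sub hf2) hlam0 hc0 hco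
    hhL.integrable_sq hTL.integrable_sq
  have hsq : ∫ x in O, (f₁ x - f₂ x) ^ 2
      ≤ 4 * Real.exp (lam * B) / c ^ 2 * ∫ x in O, transport u₁ (fun x => f₁ x - f₂ x) x ^ 2 := by
    rw [div_mul_eq_mul_div, le_div_iff₀ (by positivity), mul_comm]
    exact hen.trans_eq (by ring)
  calc l2Norm O (fun x => f₁ x - f₂ x)
      ≤ ENNReal.ofReal K * l2Norm O (transport u₁ (fun x => f₁ x - f₂ x)) := by
        rw [l2Norm_eq_ofReal_sqrt hhL, l2Norm_eq_ofReal_sqrt hTL, ← ENNReal.ofReal_mul hK0.le, hK,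
          ← Real.sqrt_mul (by positivity)]
        exact ENNReal.ofReal_le_ofReal (Real.sqrt_le_sqrt hsq)
    _ ≤ ENNReal.ofReal K * ((1 + 2 * d) * Y) := mul_le_mul_right hT _
    _ = ENNReal.ofReal K * (1 + 2 * d) * Y := by ring
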